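/- Let $K$ be an algebraically closed field of arbitrary characteristic, $\mathbb P^n=\mathbb P^n_K$ and $R=K[X_0,\dots,X_n]$. For distinct points $P_1,\dots,P_s\in\mathbb P^n$ with defining homogeneous prime ideals $\wp_1,\dots,\wp_s\subset R$ and integers $m_1,\dots,m_s\ge 1$, let $Z=m_1P_1+\cdots+m_sP_s$ denote the fat points defined by $I=\wp_1^{m_1}\cap\cdots\cap\wp_s^{m_s}$; $Z$ is non-degenerate if $P_1,\dots,P_s$ span $\mathbb P^n$, and equimultiple if $m_1=\cdots=m_s$. Let $\operatorname{reg}(Z)$ be the least integer $t$ such that $\dim_K (R/I)_t=\sum_{i=1}^s\binom{m_i+n-1}{n}$. Segre's bound is $T(Z)=\max\{T_j(Z) : j=1,\dots,n\}$, where $$T_j(Z)=\max\left\{\left\lfloor\frac{\sum_{l=1}^q m_{i_l}+j-2}{j}\right\rfloor : P_{i_1},\dots,P_{i_q}\text{ lie on a } j\text{-dimensional linear subspace}\right\}.$$ (a) Let $l_1,l_2$ be two distinct lines in $\mathbb P^2$ and let $P_1,\dots,P_6\in\mathbb P^2$ be six distinct points with $P_1,P_2,P_3\in l_1\setminus l_2$,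 $P_4,P_5\in l_2\setminus l_1$ and $P_6\notin l_1\cup l_2$. Then for every integer $m\ge1$ the fat points $Z=mP_1+\cdots+mP_6$ are non-degenerate and $T_1(Z)=3m-1$, $T_2(Z)=3m=T(Z)$, $\operatorname{reg}(Z)=3m-1<T(Z)$. (b) For all integers $m\ge1$ and $n\ge2$ there are $n+4$ non-degenerate equimultiple fat points $Z=mP_1+\cdots+mP_{n+4}$ in $\mathbb P^n$ with $$\operatorname{reg}(Z)=3m-1<T(Z)=3m .$$ Moreover the points can be chosen so that $P_1,\dots,P_6$ lie in a plane of $\mathbb P^n$ containing two distinct lines $l_1,l_2$ with $P_1,P_2,P_3\in l_1\setminus l_2$, $P_4,P_5\in l_2\setminus l_1$, $P_6\notin l_1\cup l_2$, and so that $P_4,\dots,P_{n+4}$ span $\mathbb P^n$. -/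

import Mathlib

open scoped LinearAlgebra.Projectivization

noncomputable section

namespace FatPoints

variable {K : Type*} [Field K] {n s : ℕ}

/-- Projective `n`-space over `K`: the lines through the origin of `K ^ (n + 1)`. -/
abbrev PSpace (K : Type*) [Field K] (n : ℕ) : Type _ := ℙ K (Fin (n + 1) → K)

/-- The defining homogeneous ideal of the point `P` in `K[X_0, …, X_n]`: the ideal generated by
the homogeneous polynomials which vanish at `P` (on the whole line in `K ^ (n + 1)` that `P`
stands for, so that no choice of coordinates of `P` is involved). -/
def pointIdeal (P : PSpace K n) : Ideal (MvPolynomial (Fin (n + 1)) K) :=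
  Ideal.span {f | (∃ d : ℕ, f.IsHomogeneous d) ∧ ∀ v ∈ P.submodule, MvPolynomial.eval v f = 0}

/-- The ideal `I = ℘_1 ^ m_1 ∩ ⋯ ∩ ℘_s ^ m_s` of the fat points `m_1 P_1 + ⋯ + m_s P_s`. -/
def fatIdeal (P : Fin s → PSpace K n) (m : Fin s → ℕ) : Ideal (MvPolynomial (Fin (n + 1)) K) :=
  ⨅ i, pointIdeal (P i) ^ m i

/-- The degree `t` component `(R / I)_t` of the quotient of `R = K[X_0, …, X_n]` by `I`: the image
of the space of homogeneous polynomials of degree `t`. -/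
def quotientComponent (I : Ideal (MvPolynomial (Fin (n + 1)) K)) (t : ℕ) :
    Submodule K (MvPolynomial (Fin (n + 1)) K ⧸ I) :=
  (MvPolynomial.homogeneousSubmodule (Fin (n + 1)) K t).map (Ideal.Quotient.mkₐ K I).toLinearMap

/-- The Hilbert function `t ↦ dim_K (R / I)_t`. -/
def hilbertFunction (I : Ideal (MvPolynomial (Fin (n + 1)) K)) (t : ℕ) : ℕ :=
  Module.finrank K (quotientComponent I t)

/-- The multiplicity `∑ i, binom (m_i + n - 1) n` of fat points in projective `n`-space. -/
def multiplicity (n : ℕ) (m : Fin s → ℕ) : ℕ :=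
  ∑ i, (m i + n - 1).choose n

/-- The regularity index of the fat points `m_1 P_1 + ⋯ + m_s P_s`: the least `t` at which the
Hilbert function takes the value `multiplicity n m`. -/
def regIndex (P : Fin s → PSpace K n) (m : Fin s → ℕ) : ℕ :=
  sInf {t : ℕ | hilbertFunction (fatIdeal P m) t = multiplicity n m}

/-- The points `P_i`, `i ∈ S`, lie on a `j`-dimensional linear subspace of projective `n`-space,
that is, on the projectivization of a `(j + 1)`-dimensional subspace of `K ^ (n + 1)`. -/
def LieOnLinearSubspace (P : Fin s → PSpace K n) (j : ℕ) (S : Finset (Fin s)) : Prop :=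
  ∃ L : Submodule K (Fin (n + 1) → K),
    Module.finrank K L = j + 1 ∧ ∀ i ∈ S, (P i).submodule ≤ L

open Classical in
/-- `T_j(Z)`: the maximum of `⌊(∑ i ∈ S, m_i + j - 2) / j⌋` over all families `S` of points of
support lying on a `j`-dimensional linear subspace. -/
def segreT (P : Fin s → PSpace K n) (m : Fin s → ℕ) (j : ℕ) : ℕ :=
  (Finset.univ.filter fun S : Finset (Fin s) => LieOnLinearSubspace P j S).sup
    fun S => (∑ i ∈ S, m i + j - 2) / j

/-- Segre's bound `T(Z) = max {T_j(Z) | j = 1, …, n}`. -/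
def segreBound (P : Fin s → PSpace K n) (m : Fin s → ℕ) : ℕ :=
  (Finset.Icc 1 n).sup (segreT P m)

/-- The points `P_i` span projective `n`-space. -/
def Nondegenerate {ι : Type*} (P : ι → PSpace K n) : Prop :=
  ⨆ i, (P i).submodule = ⊤

/-- The point `P` lies on the projectivization of the linear subspace `L`. -/
def LiesOn (P : PSpace K n) (L : Submodule K (Fin (n + 1) → K)) : Prop :=
  P.submodule ≤ L

/-- Six distinct points in a plane of projective `n`-space: the first three on a line `l₁` and off
a second line `l₂` of this plane, the next two on `l₂` and off `l₁`, the last one off both. -/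
def IsPlanarSix (Q : Fin 6 → PSpace K n) : Prop :=
  Function.Injective Q ∧
  ∃ α l₁ l₂ : Submodule K (Fin (n + 1) → K),
    Module.finrank K α = 3 ∧ Module.finrank K l₁ = 2 ∧ Module.finrank K l₂ = 2 ∧
    l₁ ≤ α ∧ l₂ ≤ α ∧ l₁ ≠ l₂ ∧
    (∀ i : Fin 6, i.val < 3 → LiesOn (Q i) l₁ ∧ ¬ LiesOn (Q i) l₂) ∧
    (∀ i : Fin 6, 3 ≤ i.val → i.val < 5 → LiesOn (Q i) l₂ ∧ ¬ LiesOn (Q i) l₁) ∧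
    LiesOn (Q 5) α ∧ ¬ LiesOn (Q 5) l₁ ∧ ¬ LiesOn (Q 5) l₂

end FatPoints

end

/-!
Segre's bound is attained at six coplanar points, whereas the regularity index is determined by
three collinear ones alone. Both parts of the theorem concern configurations (`FatPoints.IsConfig`)
of three points on a line `l` together with `n + 1` points `E_0, …, E_n` off `l` which span the
space, the plane of `E_0, E_1, E_2` containing `l`; in part (a) one has `n = 2`.

*Jets.* In an affine chart around a point `P`, given by a basis of `K ^ (n + 1)` whose first vector
spans `P`, every polynomial has a jet of order `m`, that is, a class in
`K[y_1, …, y_n] / (y_1, …, y_n) ^ m`, a space of dimension `binom (m + n - 1) n`. A form lies in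
`℘ ^ m` if and only if its jet of order `m` at `P` vanishes (`FatPoints.mem_pow_iff_chart_mem_pow`).
So the Hilbert function at `t` equals the multiplicity if and only if the forms of degree `t` have
arbitrary jets at all the points (`FatPoints.hilbertFunction_eq_multiplicity_iff`).

*Upper bound.* Let every point be separated from all others by a quadric `q`. Then `q ^ m` kills the
jets at the other points and is a unit in the jets at this one, while forms of degree `m - 1` have
arbitrary jets of order `m` at a single point. Products `q ^ m * g` with `g` of degree `m - 1`
therefore realize all jets in degree `3 * m - 1` (`FatPoints.map_multiJet_eq_top`). For the points
of a configuration such quadrics are given in `FatPoints.IsConfig.exists_quadric`.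

*Lower bound.* If forms of degree `t` have arbitrary jets, then some form of degree `t` vanishes
along `l` to order exactly `m - 1` at one of the three collinear points and to order at least `m` at
the two others, so that `t ≥ 3 * m - 1` (`FatPoints.three_mul_le_of_map_multiJet_eq_top`).

*Segre's bound.* A `j`-dimensional linear subspace contains at most `j + 1` of the points `E_k`, and
a line containing two of the three collinear points is `l`. Hence at most three points of a
configuration are collinear, while at most `j + 4` lie on a `j`-dimensional subspace, with equality
for the plane of `E_0, E_1, E_2`. This gives `T_1 = 3 * m - 1` and `T_2 = T = 3 * m`.
-/

noncomputable section

namespace FatPoints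

open MvPolynomial Module

variable {K : Type*} [Field K] {n s : ℕ}

/-! ### Linear forms -/

/-- A linear functional on `K ^ (n + 1)`, viewed as a linear form in `K[X_0, …, X_n]`. -/
def linForm : Dual K (Fin (n + 1) → K) →ₗ[K] MvPolynomial (Fin (n + 1)) K where
  toFun φ := ∑ i, C (φ (Pi.single i 1)) * X i
  map_add' φ ψ := by simp [add_mul, Finset.sum_add_distrib]
  map_smul' c φ := by simp [Finset.smul_sum, smul_eq_C_mul, mul_assoc]

theorem linForm_apply (φ : Dual K (Fin (n + 1) → K)) :
    linForm φ = ∑ i, C (φ (Pi.single i 1)) * X i := rfl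

theorem linForm_isHomogeneous (φ : Dual K (Fin (n + 1) → K)) : (linForm φ).IsHomogeneous 1 :=
  IsHomogeneous.sum _ _ _ fun i _ => isHomogeneous_C_mul_X _ i

theorem sum_dual_single_mul (φ : Dual K (Fin (n + 1) → K)) (v : Fin (n + 1) → K) :
    ∑ i, φ (Pi.single i 1) * v i = φ v := by
  conv_rhs => rw [pi_eq_sum_univ' v, map_sum]
  refine Finset.sum_congr rfl fun i _ => ?_
  simp [mul_comm]

@[simp]
theorem eval_linForm (φ : Dual K (Fin (n + 1) → K)) (v : Fin (n + 1) → K) :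
    eval v (linForm φ) = φ v := by
  simp [linForm_apply, sum_dual_single_mul]

theorem linForm_proj (i : Fin (n + 1)) :
    linForm (LinearMap.proj i : Dual K (Fin (n + 1) → K)) = X i := by
  simp [linForm_apply, Pi.single_apply]

/-! ### The affine chart at a point -/

/-- The restriction of polynomial functions to the affine chart `b 0 + ∑ k, y_k • b (k + 1)`
around the point spanned by `b 0`. -/
def chart (b : Basis (Fin (n + 1)) K (Fin (n + 1) → K)) :
    MvPolynomial (Fin (n + 1)) K →ₐ[K] MvPolynomial (Fin n) K :=
  aeval fun i => C (b 0 i) + ∑ k : Fin n, C (b k.succ i) * X k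

variable (b : Basis (Fin (n + 1)) K (Fin (n + 1) → K))

theorem chart_linForm (φ : Dual K (Fin (n + 1) → K)) :
    chart b (linForm φ) = C (φ (b 0)) + ∑ k : Fin n, C (φ (b k.succ)) * X k := by
  simp only [linForm_apply, chart, map_sum, map_mul, aeval_X, algHom_C, algebraMap_eq, mul_add,
    Finset.sum_add_distrib, Finset.mul_sum]
  rw [← sum_dual_single_mul φ (b 0), Finset.sum_comm, map_sum]
  simp only [map_mul]
  congr 1
  refine Finset.sum_congr rfl fun k _ => ?_
  rw [← sum_dual_single_mul φ (b k.succ), map_sum, Finset.sum_mul]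
  simp only [map_mul, mul_assoc]

theorem chart_coord_zero : chart b (linForm (b.coord 0)) = 1 := by
  rw [chart_linForm]
  simp

theorem chart_coord_succ (k : Fin n) : chart b (linForm (b.coord k.succ)) = X k := by
  rw [chart_linForm]
  simp [Finsupp.single_apply, Fin.succ_ne_zero]

theorem constantCoeff_chart (f : MvPolynomial (Fin (n + 1)) K) :
    constantCoeff (chart b f) = eval (b 0) f := by
  have h : (constantCoeff.comp (chart b).toRingHom) = eval (b 0) := by
    apply ringHom_ext
    · intro r; simp [chart]
    · intro i; simp [chart]
  exact congrArg (fun g => g f) h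

theorem mem_idealOfVars_of_constantCoeff {p : MvPolynomial (Fin n) K}
    (h : constantCoeff p = 0) : p ∈ idealOfVars (Fin n) K := by
  rw [← pow_one (idealOfVars (Fin n) K), mem_pow_idealOfVars_iff']
  intro x hx
  have : x = 0 := by simpa [Finsupp.degree_eq_zero_iff] using hx
  rw [this]; exact h

theorem chart_mem_pow {P : PSpace K n} (hb : b 0 ∈ P.submodule) {m : ℕ}
    {f : MvPolynomial (Fin (n + 1)) K} (hf : f ∈ pointIdeal P ^ m) :
    chart b f ∈ idealOfVars (Fin n) K ^ m := by
  have h1 : (pointIdeal P).map (chart b) ≤ idealOfVars (Fin n) K := by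
    rw [pointIdeal, Ideal.map_span, Ideal.span_le]
    rintro _ ⟨g, ⟨-, hg⟩, rfl⟩
    apply mem_idealOfVars_of_constantCoeff
    rw [constantCoeff_chart]
    exact hg _ hb
  have h2 := Ideal.mem_map_of_mem (chart b) hf
  rw [Ideal.map_pow] at h2
  exact Ideal.pow_right_mono h1 m h2

theorem eval_smul_of_isHomogeneous {f : MvPolynomial (Fin (n + 1)) K} {d : ℕ}
    (hf : f.IsHomogeneous d) (c : K) (v : Fin (n + 1) → K) :
    eval (c • v) f = c ^ d * eval v f := by
  simp only [eval_eq', Finset.mul_sum]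
  refine Finset.sum_congr rfl fun e he => ?_
  simp only [Pi.smul_apply, smul_eq_mul, mul_pow, Finset.prod_mul_distrib,
    Finset.prod_pow_eq_pow_sum]
  rw [← Finsupp.degree_eq_sum, Finsupp.degree_apply, ← hf.degree_eq_sum_deg_support he]
  ring

theorem mem_pointIdeal {P : PSpace K n} {v : Fin (n + 1) → K} (hv : v ∈ P.submodule) (hv0 : v ≠ 0)
    {f : MvPolynomial (Fin (n + 1)) K} {d : ℕ} (hf : f.IsHomogeneous d) (h : eval v f = 0) :
    f ∈ pointIdeal P := by
  refine Ideal.subset_span ⟨⟨d, hf⟩, fun w hw => ?_⟩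
  have hs : K ∙ v = P.submodule := by
    apply Submodule.eq_of_le_of_finrank_eq
    · simpa using hv
    · rw [finrank_span_singleton hv0, P.finrank_submodule]
  rw [← hs, Submodule.mem_span_singleton] at hw
  obtain ⟨c, rfl⟩ := hw
  rw [eval_smul_of_isHomogeneous hf, h, mul_zero]

/-- Every polynomial is a polynomial in the linear coordinates attached to a basis. -/
theorem aeval_coord_eq (f : MvPolynomial (Fin (n + 1)) K) :
    aeval (fun k => linForm (b.coord k))
      (aeval (fun i => ∑ k, C (b k i) * X k : Fin (n + 1) → MvPolynomial (Fin (n + 1)) K) f) =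
      f := by
  have h : ((aeval (fun k => linForm (b.coord k))).comp
      (aeval (fun i => ∑ k, C (b k i) * X k : Fin (n + 1) → MvPolynomial (Fin (n + 1)) K))) =
      AlgHom.id K _ := by
    ext1 i
    have hi : ∑ k, b k i • b.coord k = LinearMap.proj i :=
      b.ext fun j => by simp [Finsupp.single_apply]
    simp only [AlgHom.comp_apply, aeval_X, map_sum, AlgHom.id_apply, ← smul_eq_C_mul, map_smul]
    rw [← linForm_proj, ← hi]
    simp only [map_sum, map_smul]
  exact congrArg (fun g => g f) h

theorem degree_eq_zero_add_tail (e : Fin (n + 1) →₀ ℕ) :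
    e.degree = e 0 + e.tail.degree := by
  simp [Finsupp.degree_eq_sum, Fin.sum_univ_succ, Finsupp.tail_apply]

theorem aeval_coord_monomial (e : Fin (n + 1) →₀ ℕ) (c : K) :
    aeval (fun k => linForm (b.coord k)) (monomial e c) =
      C c * (linForm (b.coord 0) ^ e 0 * ∏ k : Fin n, linForm (b.coord k.succ) ^ e.tail k) := by
  rw [aeval_monomial, Finsupp.prod_fintype _ _ (fun _ => pow_zero _), Fin.prod_univ_succ]
  simp [Finsupp.tail_apply]

/-- In the coordinates attached to `b`, the chart is dehomogenization with respect to the first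
coordinate. -/
theorem chart_aeval_coord_monomial (e : Fin (n + 1) →₀ ℕ) (c : K) :
    chart b (aeval (fun k => linForm (b.coord k)) (monomial e c)) = monomial e.tail c := by
  rw [aeval_coord_monomial]
  simp only [map_mul, map_pow, map_prod, chart_coord_zero, chart_coord_succ, one_pow, one_mul]
  rw [algHom_C, algebraMap_eq, monomial_eq, Finsupp.prod_fintype _ _ (fun _ => pow_zero _)]

theorem linForm_coord_succ_mem {P : PSpace K n} (hb : b 0 ∈ P.submodule) (k : Fin n) :
    linForm (b.coord k.succ) ∈ pointIdeal P :=
  mem_pointIdeal hb (b.ne_zero 0) (linForm_isHomogeneous _) (by simp [Fin.succ_ne_zero])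

/-- For a form, the order of vanishing at a point can be read off in an affine chart. -/
theorem mem_pow_iff_chart_mem_pow {P : PSpace K n} (hb : b 0 ∈ P.submodule) {m t : ℕ}
    {f : MvPolynomial (Fin (n + 1)) K} (hf : f.IsHomogeneous t) :
    f ∈ pointIdeal P ^ m ↔ chart b f ∈ idealOfVars (Fin n) K ^ m := by
  refine ⟨chart_mem_pow b hb, fun h => ?_⟩
  set g := aeval (fun i => ∑ k, C (b k i) * X k : Fin (n + 1) → MvPolynomial (Fin (n + 1)) K) f
    with hg
  have hgt : g.IsHomogeneous t := by
    have := hf.aeval (fun i => ∑ k, C (b k i) * X k : Fin (n + 1) → MvPolynomial (Fin (n + 1)) K)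
      (n := 1) (fun i => IsHomogeneous.sum _ _ _ fun k _ => isHomogeneous_C_mul_X _ k)
    rwa [one_mul] at this
  have hfg : f = ∑ e ∈ g.support,
      aeval (fun k => linForm (b.coord k)) (monomial e (coeff e g)) := by
    rw [← map_sum, ← as_sum, hg, aeval_coord_eq]
  rw [hfg]
  refine Ideal.sum_mem _ fun e he => ?_
  rw [aeval_coord_monomial]
  have hme : m ≤ e.tail.degree := by
    by_contra! hlt
    rw [mem_pow_idealOfVars_iff'] at h
    have hc := h e.tail hlt
    rw [hfg, map_sum] at hc
    simp only [chart_aeval_coord_monomial, coeff_sum, coeff_monomial] at hc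
    rw [Finset.sum_eq_single_of_mem e he, if_pos rfl] at hc
    · exact mem_support_iff.mp he hc
    · -- exponents of the same degree with the same tail agree
      intro e' he' hne
      refine if_neg fun htail => hne ?_
      have h1 := hgt.degree_eq_sum_deg_support he
      have h2 := hgt.degree_eq_sum_deg_support he'
      have h3 := degree_eq_zero_add_tail e
      have h4 := degree_eq_zero_add_tail e'
      rw [Finsupp.degree_apply] at h3 h4
      rw [← Finsupp.cons_tail e, ← Finsupp.cons_tail e', htail]
      congr 1
      rw [htail] at h4
      omega
  refine Ideal.mul_mem_left _ _ (Ideal.mul_mem_left _ _ (Ideal.pow_le_pow_right hme ?_))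
  rw [Finsupp.degree_eq_sum, ← Finset.prod_pow_eq_pow_sum]
  exact Ideal.prod_mem_prod fun k _ => Ideal.pow_mem_pow (linForm_coord_succ_mem b hb k) _

/-! ### Jets -/

/-- The algebra of jets of order `m` at the origin of affine `n`-space. -/
abbrev Jets (K : Type*) [Field K] (n m : ℕ) : Type _ :=
  MvPolynomial (Fin n) K ⧸ (idealOfVars (Fin n) K ^ m)

theorem card_degree_lt (n m : ℕ) (hm : 1 ≤ m) :
    Nat.card {d : Fin n →₀ ℕ // d.degree < m} = (m + n - 1).choose n := by
  classical
  have hset : {d : Fin n →₀ ℕ | d.degree < m} =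
      ((Finset.range m).biUnion fun k => (Finset.univ : Finset (Fin n)).finsuppAntidiag k) := by
    ext d
    simp [Finsupp.degree_eq_sum]
  change Nat.card ({d : Fin n →₀ ℕ | d.degree < m} : Set _) = _
  rw [hset, Nat.card_coe_set_eq, Set.ncard_coe_finset, Finset.card_biUnion]
  · simp only [Finset.card_finsuppAntidiag_nat_eq_multichoose, Finset.card_univ, Fintype.card_fin]
    obtain ⟨m, rfl⟩ := Nat.exists_eq_add_of_le' hm
    rw [Nat.sum_range_multichoose]
    congr 1
    omega
  · intro x _ y _ hxy
    refine Finset.disjoint_left.mpr ?_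
    intro d hd hd'
    simp only [Finset.mem_finsuppAntidiag] at hd hd'
    exact hxy (hd.1.symm.trans hd'.1)

/-- The coefficients of degree less than `m` of a polynomial. -/
def lowCoeffs (K : Type*) [Field K] (n m : ℕ) :
    MvPolynomial (Fin n) K →ₗ[K] ({d : Fin n →₀ ℕ // d.degree < m} → K) :=
  LinearMap.pi fun d => lcoeff K d.1

theorem finite_degree_lt (n m : ℕ) : Finite {d : Fin n →₀ ℕ // d.degree < m} := by
  classical
  refine Set.Finite.subset (Finset.finite_toSet
    ((Finset.range m).biUnion fun k => (Finset.univ : Finset (Fin n)).finsuppAntidiag k)) ?_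
  intro d (hd : d.degree < m)
  simpa [Finsupp.degree_eq_sum] using hd

theorem ker_lowCoeffs (n m : ℕ) :
    LinearMap.ker (lowCoeffs K n m) = (idealOfVars (Fin n) K ^ m).restrictScalars K := by
  ext p
  simp [lowCoeffs, mem_pow_idealOfVars_iff', funext_iff]

theorem lowCoeffs_surjective (n m : ℕ) : Function.Surjective (lowCoeffs K n m) := by
  classical
  have := finite_degree_lt n m
  have := Fintype.ofFinite {d : Fin n →₀ ℕ // d.degree < m}
  intro c
  refine ⟨∑ d, monomial d.1 (c d), ?_⟩
  ext d
  simp [lowCoeffs, coeff_monomial, Subtype.coe_inj]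

/-- A jet of order `m` is determined by its coefficients of degree less than `m`. -/
def jetsEquiv (K : Type*) [Field K] (n m : ℕ) :
    Jets K n m ≃ₗ[K] ({d : Fin n →₀ ℕ // d.degree < m} → K) :=
  (Submodule.Quotient.restrictScalarsEquiv K (idealOfVars (Fin n) K ^ m)).symm ≪≫ₗ
    Submodule.quotEquivOfEq _ _ (ker_lowCoeffs n m).symm ≪≫ₗ
    (lowCoeffs K n m).quotKerEquivOfSurjective (lowCoeffs_surjective n m)

instance finite_jets (n m : ℕ) : Module.Finite K (Jets K n m) := by
  have := finite_degree_lt n m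
  exact Module.Finite.equiv (jetsEquiv K n m).symm

theorem finrank_jets (n m : ℕ) (hm : 1 ≤ m) :
    finrank K (Jets K n m) = (m + n - 1).choose n := by
  have := finite_degree_lt n m
  have := Fintype.ofFinite {d : Fin n →₀ ℕ // d.degree < m}
  rw [(jetsEquiv K n m).finrank_eq, finrank_fintype_fun_eq_card, ← Nat.card_eq_fintype_card,
    card_degree_lt n m hm]

/-- The jet of order `m` of a polynomial function at the point spanned by `b 0`. -/
def jet (m : ℕ) : MvPolynomial (Fin (n + 1)) K →ₐ[K] Jets K n m :=
  (Ideal.Quotient.mkₐ K _).comp (chart b)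

theorem jet_eq_mk (m : ℕ) (f : MvPolynomial (Fin (n + 1)) K) :
    jet b m f = Ideal.Quotient.mk _ (chart b f) := rfl

theorem jet_eq_zero_iff {P : PSpace K n} (hb : b 0 ∈ P.submodule) {m t : ℕ}
    {f : MvPolynomial (Fin (n + 1)) K} (hf : f.IsHomogeneous t) :
    jet b m f = 0 ↔ f ∈ pointIdeal P ^ m := by
  rw [jet_eq_mk, Ideal.Quotient.eq_zero_iff_mem, mem_pow_iff_chart_mem_pow b hb hf]

/-- Forms of degree at least `m - 1` have arbitrary jets of order `m` at a given point. -/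
theorem map_jet_eq_top {m t : ℕ} (ht : m ≤ t + 1) :
    (homogeneousSubmodule (Fin (n + 1)) K t).map (jet b m).toLinearMap = ⊤ := by
  rw [eq_top_iff]
  rintro x -
  obtain ⟨p, rfl⟩ := Ideal.Quotient.mk_surjective x
  rw [p.as_sum, map_sum]
  refine Submodule.sum_mem _ fun d _ => ?_
  rcases lt_or_ge d.degree m with hd | hd
  · refine ⟨aeval (fun k => linForm (b.coord k))
      (monomial (d.cons (t - d.degree)) (coeff d p)), ?_, ?_⟩
    · have h : (monomial (d.cons (t - d.degree)) (coeff d p)).IsHomogeneous t := by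
        apply isHomogeneous_monomial
        rw [degree_eq_zero_add_tail, Finsupp.tail_cons, Finsupp.cons_zero]
        omega
      have := h.aeval (fun k => linForm (b.coord k)) (n := 1)
        (fun k => linForm_isHomogeneous _)
      rwa [one_mul] at this
    · rw [AlgHom.toLinearMap_apply, jet_eq_mk, chart_aeval_coord_monomial, Finsupp.tail_cons]
  · have : Ideal.Quotient.mk (idealOfVars (Fin n) K ^ m) (monomial d (coeff d p)) = 0 := by
      rw [Ideal.Quotient.eq_zero_iff_mem, mem_pow_idealOfVars_iff']
      intro x hx
      rw [coeff_monomial, if_neg]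
      rintro rfl
      omega
    rw [this]
    exact Submodule.zero_mem _

/-- A form not vanishing at a point has invertible jets there. -/
theorem isUnit_jet {f : MvPolynomial (Fin (n + 1)) K} (hf : eval (b 0) f ≠ 0) (m : ℕ) :
    IsUnit (jet b m f) := by
  have h1 : chart b f - C (eval (b 0) f) ∈ idealOfVars (Fin n) K := by
    apply mem_idealOfVars_of_constantCoeff
    rw [map_sub, constantCoeff_chart, constantCoeff_C, sub_self]
  have h2 : IsNilpotent (Ideal.Quotient.mk (idealOfVars (Fin n) K ^ m)
      (chart b f - C (eval (b 0) f))) :=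
    ⟨m, by rw [← map_pow, Ideal.Quotient.eq_zero_iff_mem]; exact Ideal.pow_mem_pow h1 m⟩
  have h3 : IsUnit (Ideal.Quotient.mk (idealOfVars (Fin n) K ^ m) (C (eval (b 0) f))) :=
    ((IsUnit.mk0 _ hf).map C).map _
  have h4 := h2.isUnit_add_left_of_commute h3 (Commute.all _ _)
  rwa [← map_add, add_sub_cancel] at h4

/-! ### The Hilbert function in terms of jets -/

theorem finrank_map_eq_of_forall_eq_zero_iff {V W W' : Type*} [AddCommGroup V] [Module K V]
    [AddCommGroup W] [Module K W] [AddCommGroup W'] [Module K W'] (S : Submodule K V)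
    (f : V →ₗ[K] W) (g : V →ₗ[K] W') (h : ∀ x ∈ S, f x = 0 ↔ g x = 0) :
    finrank K (S.map f) = finrank K (S.map g) := by
  have hk : LinearMap.ker (f.domRestrict S) = LinearMap.ker (g.domRestrict S) := by
    ext ⟨x, hx⟩
    simpa using h x hx
  rw [← LinearMap.range_domRestrict, ← LinearMap.range_domRestrict,
    ← (LinearMap.quotKerEquivRange _).finrank_eq, ← (LinearMap.quotKerEquivRange _).finrank_eq, hk]

/-- The jets of order `m` of a polynomial function at several points. -/
def multiJet (b : Fin s → Basis (Fin (n + 1)) K (Fin (n + 1) → K)) (m : ℕ) :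
    MvPolynomial (Fin (n + 1)) K →ₗ[K] (Fin s → Jets K n m) :=
  LinearMap.pi fun i => (jet (b i) m).toLinearMap

theorem multiJet_apply (b : Fin s → Basis (Fin (n + 1)) K (Fin (n + 1) → K)) (m : ℕ)
    (f : MvPolynomial (Fin (n + 1)) K) (i : Fin s) : multiJet b m f i = jet (b i) m f := rfl

/-- Equimultiple fat points impose independent conditions on the forms of degree `t` if and only
if these forms have arbitrary jets at the points. -/
theorem hilbertFunction_eq_multiplicity_iff {P : Fin s → PSpace K n}
    {b : Fin s → Basis (Fin (n + 1)) K (Fin (n + 1) → K)} (hb : ∀ i, b i 0 ∈ (P i).submodule)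
    {m t : ℕ} (hm : 1 ≤ m) :
    hilbertFunction (fatIdeal P fun _ => m) t = multiplicity n (fun _ : Fin s => m) ↔
      (homogeneousSubmodule (Fin (n + 1)) K t).map (multiJet b m) = ⊤ := by
  have h1 : hilbertFunction (fatIdeal P fun _ => m) t =
      finrank K ((homogeneousSubmodule (Fin (n + 1)) K t).map (multiJet b m)) := by
    refine finrank_map_eq_of_forall_eq_zero_iff _ _ _ fun f hf => ?_
    rw [AlgHom.toLinearMap_apply, Ideal.Quotient.mkₐ_eq_mk, Ideal.Quotient.eq_zero_iff_mem,
      fatIdeal, Ideal.mem_iInf, funext_iff]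
    exact forall_congr' fun i => (jet_eq_zero_iff (b i) (hb i) hf).symm
  have h2 : multiplicity n (fun _ : Fin s => m) = finrank K (Fin s → Jets K n m) := by
    rw [finrank_pi_fintype]
    simp [multiplicity, finrank_jets n m hm]
  rw [h1, h2]
  exact ⟨Submodule.eq_top_of_finrank_eq, fun h => by rw [h, finrank_top]⟩

/-- If forms of degree `r` separate the points, then forms of degree `t ≥ (r + 1) * m - 1` have
arbitrary jets of order `m` at the points: the `m`-th power of a form separating one of the points
from the others kills the jets at the others and is a unit in the jets at this one. -/
theorem map_multiJet_eq_top {P : Fin s → PSpace K n}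
    {b : Fin s → Basis (Fin (n + 1)) K (Fin (n + 1) → K)} (hb : ∀ i, b i 0 ∈ (P i).submodule)
    {r m t : ℕ} (ht : (r + 1) * m ≤ t + 1)
    (hq : ∀ i, ∃ q : MvPolynomial (Fin (n + 1)) K, q.IsHomogeneous r ∧
      (∀ j, j ≠ i → eval (b j 0) q = 0) ∧ eval (b i 0) q ≠ 0) :
    (homogeneousSubmodule (Fin (n + 1)) K t).map (multiJet b m) = ⊤ := by
  rcases Nat.eq_zero_or_pos m with rfl | hm
  · have : Subsingleton (Jets K n 0) := by
      rw [Jets, pow_zero, Ideal.one_eq_top]; infer_instance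
    exact Subsingleton.elim _ _
  rw [eq_top_iff, ← LinearMap.iSup_range_single, iSup_le_iff]
  rintro i _ ⟨x, rfl⟩
  obtain ⟨q, hqr, hqj, hqi⟩ := hq i
  obtain ⟨u, hu⟩ := isUnit_jet (b i) hqi m
  have hrm : (r + 1) * m = r * m + m := by ring
  obtain ⟨g, hg, hgx⟩ : (↑(u ^ m)⁻¹ * x) ∈
      (homogeneousSubmodule (Fin (n + 1)) K (t - r * m)).map (jet (b i) m).toLinearMap := by
    rw [map_jet_eq_top (b i) (by omega)]
    trivial
  refine ⟨q ^ m * g, ?_, ?_⟩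
  · have := (hqr.pow m).mul hg
    rwa [Nat.add_sub_cancel' (by omega)] at this
  · ext j
    rw [multiJet_apply, map_mul]
    by_cases hj : j = i
    · subst hj
      rw [AlgHom.toLinearMap_apply] at hgx
      rw [hgx, map_pow, ← hu, LinearMap.single_apply, Pi.single_eq_same,
        ← Units.val_pow_eq_pow_val, Units.mul_inv_cancel_left]
    · have h0 : jet (b j) m (q ^ m) = 0 :=
        (jet_eq_zero_iff (b j) (hb j) (hqr.pow m)).2
          (Ideal.pow_mem_pow (mem_pointIdeal (hb j) ((b j).ne_zero 0) hqr (hqj j hj)) m)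
      rw [h0, zero_mul, LinearMap.single_apply, Pi.single_eq_of_ne hj]

/-! ### Bases with prescribed first vectors -/

theorem exists_linearIndependent_extension {V : Type*} [AddCommGroup V] [Module K V] {k : ℕ}
    (u : Fin k → V) (hu : LinearIndependent K u) {d : ℕ} (hkd : k ≤ d) (hd : d ≤ finrank K V) :
    ∃ u' : Fin d → V, LinearIndependent K u' ∧ ∀ i, u' (Fin.castLE hkd i) = u i := by
  induction d, hkd using Nat.le_induction with
  | base => exact ⟨u, hu, fun i => rfl⟩
  | succ d hkd ih =>
    obtain ⟨u', hu', h⟩ := ih (by omega)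
    obtain ⟨x, hx⟩ := exists_linearIndependent_snoc_of_lt_finrank hu' (by omega)
    refine ⟨_, hx, fun i => ?_⟩
    have : Fin.castLE (Nat.le_succ_of_le hkd) i = (Fin.castLE hkd i).castSucc := rfl
    rw [this, Fin.snoc_castSucc, h]

theorem exists_basis_extension {k : ℕ} (u : Fin k → Fin (n + 1) → K) (hu : LinearIndependent K u)
    (hk : k ≤ n + 1) :
    ∃ b : Basis (Fin (n + 1)) K (Fin (n + 1) → K), ∀ i, b (Fin.castLE hk i) = u i := by
  obtain ⟨u', hu', h⟩ := exists_linearIndependent_extension u hu hk (by simp)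
  exact ⟨basisOfLinearIndependentOfCardEqFinrank hu' (by simp), fun i => by simp [h]⟩

theorem exists_basis_zero_eq {v : Fin (n + 1) → K} (hv : v ≠ 0) :
    ∃ b : Basis (Fin (n + 1)) K (Fin (n + 1) → K), b 0 = v := by
  obtain ⟨b, hb⟩ := exists_basis_extension ![v] (LinearIndependent.of_subsingleton 0 hv) (by omega)
  exact ⟨b, hb 0⟩

theorem exists_basis_zero_eq_succ_eq (hn : 1 ≤ n) {v w : Fin (n + 1) → K}
    (h : LinearIndependent K ![v, w]) :
    ∃ (b : Basis (Fin (n + 1)) K (Fin (n + 1) → K)) (k : Fin n), b 0 = v ∧ b k.succ = w := by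
  obtain ⟨b, hb⟩ := exists_basis_extension ![v, w] h (by omega)
  exact ⟨b, ⟨0, hn⟩, hb 0, hb 1⟩

/-! ### Restriction to a line -/

/-- The restriction of polynomial functions to the parametrized line `v + x • w`. -/
def lineMap (v w : Fin (n + 1) → K) : MvPolynomial (Fin (n + 1)) K →ₐ[K] Polynomial K :=
  aeval fun i => Polynomial.C (v i) + Polynomial.C (w i) * Polynomial.X

theorem natDegree_lineMap_le (v w : Fin (n + 1) → K) {t : ℕ} {f : MvPolynomial (Fin (n + 1)) K}
    (hf : f.IsHomogeneous t) : (lineMap v w f).natDegree ≤ t := by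
  have := MvPolynomial.aeval_natDegree_le f hf.totalDegree_le
    (fun i => Polynomial.C (v i) + Polynomial.C (w i) * Polynomial.X) (n := 1) (fun i => by
      compute_degree)
  rwa [mul_one] at this

theorem eval_lineMap (v w : Fin (n + 1) → K) (a : K) (f : MvPolynomial (Fin (n + 1)) K) :
    (lineMap v w f).eval a = eval (v + a • w) f := by
  have h : (Polynomial.evalRingHom a).comp (lineMap v w).toRingHom = eval (v + a • w) := by
    apply ringHom_ext
    · intro r; simp [lineMap]
    · intro i; simp [lineMap, mul_comm a]
  exact congrArg (fun g => g f) h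

theorem dvd_lineMap {P : PSpace K n} {v w : Fin (n + 1) → K} {a : K}
    (h : v + a • w ∈ P.submodule) {m : ℕ} {f : MvPolynomial (Fin (n + 1)) K}
    (hf : f ∈ pointIdeal P ^ m) : (Polynomial.X - Polynomial.C a) ^ m ∣ lineMap v w f := by
  have h1 : (pointIdeal P).map (lineMap v w) ≤ Ideal.span {Polynomial.X - Polynomial.C a} := by
    rw [pointIdeal, Ideal.map_span, Ideal.span_le]
    rintro _ ⟨g, ⟨-, hg⟩, rfl⟩
    rw [SetLike.mem_coe, Ideal.mem_span_singleton, Polynomial.dvd_iff_isRoot, Polynomial.IsRoot,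
      eval_lineMap]
    exact hg _ h
  have h2 := Ideal.mem_map_of_mem (lineMap v w) hf
  rw [Ideal.map_pow] at h2
  have h3 := Ideal.pow_right_mono h1 m h2
  rwa [Ideal.span_singleton_pow, Ideal.mem_span_singleton] at h3

/-- Restriction to the coordinate line through `b 0` in direction `b (k + 1)` factors through the
chart. -/
theorem lineMap_eq_aeval_chart (b : Basis (Fin (n + 1)) K (Fin (n + 1) → K)) (k : Fin n)
    (f : MvPolynomial (Fin (n + 1)) K) :
    lineMap (b 0) (b k.succ) f =
      aeval (Pi.single k Polynomial.X : Fin n → Polynomial K) (chart b f) := by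
  have h : lineMap (b 0) (b k.succ) =
      (aeval (Pi.single k Polynomial.X : Fin n → Polynomial K)).comp (chart b) := by
    ext1 i
    simp [lineMap, chart, Pi.single_apply]
  rw [h]; rfl

theorem X_pow_dvd_aeval_single (k : Fin n) {m : ℕ} {p : MvPolynomial (Fin n) K}
    (hp : p ∈ idealOfVars (Fin n) K ^ m) :
    Polynomial.X ^ m ∣ aeval (Pi.single k Polynomial.X : Fin n → Polynomial K) p := by
  have h1 : (idealOfVars (Fin n) K).map
      (aeval (Pi.single k Polynomial.X : Fin n → Polynomial K)) ≤ Ideal.span {Polynomial.X} := by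
    rw [idealOfVars, Ideal.map_span, Ideal.span_le]
    rintro _ ⟨_, ⟨i, rfl⟩, rfl⟩
    rw [SetLike.mem_coe, Ideal.mem_span_singleton, aeval_X, Pi.single_apply]
    split_ifs <;> simp
  have h2 := Ideal.mem_map_of_mem (aeval (Pi.single k Polynomial.X : Fin n → Polynomial K)) hp
  rw [Ideal.map_pow] at h2
  have h3 := Ideal.pow_right_mono h1 m h2
  rwa [Ideal.span_singleton_pow, Ideal.mem_span_singleton] at h3

/-- If forms of degree `t` have arbitrary jets of order `m` at a family of points containing
three distinct points of a line, then `t ≥ 3 * m - 1`: a form which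
vanishes to order exactly `m - 1` along the line at the first point and to order `m` at the two
others has degree at least `3 * m - 1`. -/
theorem three_mul_le_of_map_multiJet_eq_top {P : Fin s → PSpace K n}
    {b : Fin s → Basis (Fin (n + 1)) K (Fin (n + 1) → K)} (hb : ∀ i, b i 0 ∈ (P i).submodule)
    {m t : ℕ} (hm : 1 ≤ m)
    (htop : (homogeneousSubmodule (Fin (n + 1)) K t).map (multiJet b m) = ⊤)
    {i₁ i₂ i₃ : Fin s} {k : Fin n} {x y : K} (hx : x ≠ 0) (hy : y ≠ 0) (hxy : x ≠ y)
    (h12 : i₂ ≠ i₁) (h13 : i₃ ≠ i₁)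
    (h2 : b i₁ 0 + x • b i₁ k.succ ∈ (P i₂).submodule)
    (h3 : b i₁ 0 + y • b i₁ k.succ ∈ (P i₃).submodule) : 3 * m ≤ t + 1 := by
  obtain ⟨f, hf, hfj⟩ : Pi.single i₁ (Ideal.Quotient.mk _ (X k ^ (m - 1))) ∈
      (homogeneousSubmodule (Fin (n + 1)) K t).map (multiJet b m) := by
    rw [htop]; trivial
  replace hf : f.IsHomogeneous t := hf
  set g := lineMap (b i₁ 0) (b i₁ k.succ) f with hg
  have hg1 : Polynomial.X ^ m ∣ g - Polynomial.X ^ (m - 1) := by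
    have h := congrFun hfj i₁
    rw [multiJet_apply, Pi.single_eq_same, jet_eq_mk, Ideal.Quotient.eq] at h
    have := X_pow_dvd_aeval_single k h
    rwa [map_sub, ← lineMap_eq_aeval_chart, map_pow, aeval_X, Pi.single_eq_same] at this
  have hvan : ∀ {j : Fin s}, j ≠ i₁ → f ∈ pointIdeal (P j) ^ m := fun {j} hj => by
    have h := congrFun hfj j
    rw [multiJet_apply, Pi.single_eq_of_ne hj] at h
    exact (jet_eq_zero_iff (b j) (hb j) hf).1 h
  have hg2 := dvd_lineMap h2 (hvan h12)
  have hg3 := dvd_lineMap h3 (hvan h13)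
  rw [← hg] at hg2 hg3
  have hg0 : g ≠ 0 := by
    intro h0
    rw [h0, zero_sub, dvd_neg, Polynomial.X_pow_dvd_iff] at hg1
    have := hg1 (m - 1) (by omega)
    simp at this
  have hg1' : Polynomial.X ^ (m - 1) ∣ g := by
    have := dvd_add ((pow_dvd_pow Polynomial.X (Nat.sub_le m 1)).trans hg1)
      (dvd_refl (Polynomial.X ^ (m - 1) : Polynomial K))
    rwa [sub_add_cancel] at this
  have hc : ∀ {a c : K}, a ≠ c →
      IsCoprime (Polynomial.X - Polynomial.C a) (Polynomial.X - Polynomial.C c) :=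
    fun h => Polynomial.isCoprime_X_sub_C_of_isUnit_sub (sub_ne_zero.2 h).isUnit
  have h12c : IsCoprime (Polynomial.X ^ (m - 1)) ((Polynomial.X - Polynomial.C x) ^ m) := by
    have := hc hx.symm
    rw [Polynomial.C_0, sub_zero] at this
    exact this.pow
  have h13c : IsCoprime (Polynomial.X ^ (m - 1)) ((Polynomial.X - Polynomial.C y) ^ m) := by
    have := hc hy.symm
    rw [Polynomial.C_0, sub_zero] at this
    exact this.pow
  have hdvd := (h13c.mul_left ((hc hxy).pow)).mul_dvd (h12c.mul_dvd hg1' hg2) hg3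
  have hdeg := Polynomial.natDegree_le_of_dvd hdvd hg0
  rw [Polynomial.natDegree_mul (mul_ne_zero (pow_ne_zero _ Polynomial.X_ne_zero)
      (pow_ne_zero _ (Polynomial.X_sub_C_ne_zero x)))
      (pow_ne_zero _ (Polynomial.X_sub_C_ne_zero y)),
    Polynomial.natDegree_mul (pow_ne_zero _ Polynomial.X_ne_zero)
      (pow_ne_zero _ (Polynomial.X_sub_C_ne_zero x))] at hdeg
  simp only [Polynomial.natDegree_pow, Polynomial.natDegree_X, Polynomial.natDegree_X_sub_C,
    mul_one] at hdeg
  have := natDegree_lineMap_le (b i₁ 0) (b i₁ k.succ) hf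
  rw [← hg] at this
  omega

theorem rep_mem (P : PSpace K n) : P.rep ∈ P.submodule := by
  rw [P.submodule_eq]; exact Submodule.mem_span_singleton_self _

theorem submodule_le_iff (P : PSpace K n) (L : Submodule K (Fin (n + 1) → K)) :
    P.submodule ≤ L ↔ P.rep ∈ L := by
  rw [P.submodule_eq, Submodule.span_singleton_le_iff_mem]

theorem linearIndependent_rep_pair {P Q : PSpace K n} (h : P ≠ Q) :
    LinearIndependent K ![P.rep, Q.rep] := by
  have := Projectivization.independent_iff.1 ((Projectivization.independent_pair_iff_ne P Q).2 h)
  have e : Projectivization.rep ∘ ![P, Q] = ![P.rep, Q.rep] := by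
    ext i : 1
    fin_cases i <;> rfl
  rwa [e] at this

/-- Two distinct points of a line span it. -/
theorem eq_span_rep_pair {P Q : PSpace K n} (h : P ≠ Q) {l : Submodule K (Fin (n + 1) → K)}
    (hl : finrank K l = 2) (hP : P.submodule ≤ l) (hQ : Q.submodule ≤ l) :
    Submodule.span K {P.rep, Q.rep} = l := by
  rw [submodule_le_iff] at hP hQ
  apply Submodule.eq_of_le_of_finrank_eq
  · rw [Submodule.span_le]
    rintro _ (rfl | rfl)
    exacts [hP, hQ]
  · have := finrank_span_eq_card (linearIndependent_rep_pair h)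
    rw [Matrix.range_cons_cons_empty] at this
    simpa [hl] using this

/-- The fat points of multiplicity `m` supported on points which are separated by quadrics, and of
which three are collinear, have regularity index `3 * m - 1`. -/
theorem regIndex_eq_three_mul_sub_one [Infinite K] (hn : 1 ≤ n) {P : Fin s → PSpace K n} {m : ℕ}
    (hm : 1 ≤ m)
    (hq : ∀ i, ∃ q : MvPolynomial (Fin (n + 1)) K, q.IsHomogeneous 2 ∧
      (∀ j, j ≠ i → eval (P j).rep q = 0) ∧ eval (P i).rep q ≠ 0)
    {l : Submodule K (Fin (n + 1) → K)} (hl : finrank K l = 2) {i₁ i₂ i₃ : Fin s}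
    (h12 : P i₁ ≠ P i₂) (h13 : P i₁ ≠ P i₃) (h23 : P i₂ ≠ P i₃) (h1 : (P i₁).submodule ≤ l)
    (h2 : (P i₂).submodule ≤ l) (h3 : (P i₃).submodule ≤ l) :
    regIndex P (fun _ => m) = 3 * m - 1 := by
  refine IsLeast.csInf_eq ⟨?_, fun t ht => ?_⟩
  · choose b hb using fun i => exists_basis_zero_eq (P i).rep_nonzero
    rw [Set.mem_ofPred_eq,
      hilbertFunction_eq_multiplicity_iff (b := b) (fun i => hb i ▸ rep_mem (P i)) hm]
    refine map_multiJet_eq_top (r := 2) (fun i => hb i ▸ rep_mem (P i)) (by omega) ?_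
    simpa only [hb] using hq
  · have h3' := (submodule_le_iff _ _).1 h3
    rw [← eq_span_rep_pair h12 hl h1 h2, Submodule.mem_span_pair] at h3'
    obtain ⟨α, β, h3'⟩ := h3'
    have hα : α ≠ 0 := by
      rintro rfl
      refine (LinearIndependent.pair_iff' (P i₂).rep_nonzero).1 (linearIndependent_rep_pair h23) β ?_
      rw [← h3', zero_smul, zero_add]
    have hβ : β ≠ 0 := by
      rintro rfl
      refine (LinearIndependent.pair_iff' (P i₁).rep_nonzero).1 (linearIndependent_rep_pair h13) α ?_
      rw [← h3', zero_smul, add_zero]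
    -- a point of the line different from the three given ones, to be put at infinity
    classical
    obtain ⟨c, hc⟩ := Infinite.exists_notMem_finset ({0, β / α} : Finset K)
    simp only [Finset.mem_insert, Finset.mem_singleton, not_or] at hc
    obtain ⟨hc0, hc1⟩ := hc
    have hd : c * α - β ≠ 0 := fun h => hc1 ((eq_div_iff hα).2 (sub_eq_zero.1 h))
    have hli : LinearIndependent K ![(P i₁).rep, (P i₁).rep + c • (P i₂).rep] := by
      have h := linearIndependent_rep_pair h12
      rw [LinearIndependent.pair_iff] at h ⊢
      intro x y hxy
      have h := h (x + y) (y * c) (by rw [← hxy]; module)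
      have hy : y = 0 := (mul_eq_zero.1 h.2).resolve_right hc0
      exact ⟨by simpa [hy] using h.1, hy⟩
    obtain ⟨b₁, k, hb0, hbk⟩ := exists_basis_zero_eq_succ_eq hn hli
    choose b hb using fun i => exists_basis_zero_eq (P i).rep_nonzero
    have hb' : ∀ i, Function.update b i₁ b₁ i 0 ∈ (P i).submodule := by
      intro i
      by_cases hi : i = i₁
      · subst hi; rw [Function.update_self, hb0]; exact rep_mem _
      · rw [Function.update_of_ne hi, hb]; exact rep_mem _
    rw [Set.mem_ofPred_eq, hilbertFunction_eq_multiplicity_iff hb' hm] at ht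
    -- in the parametrization `P i₁ + x • w` with `w = P i₁ + c • P i₂`, the points `P i₂` and `P i₃`
    -- have the parameters `-1` and `β / (c * α - β)`
    have hxy : -1 ≠ β / (c * α - β) := by
      intro h
      rw [eq_div_iff hd] at h
      exact mul_ne_zero hc0 hα (by linear_combination -h)
    have := three_mul_le_of_map_multiJet_eq_top hb' hm ht (i₁ := i₁) (i₂ := i₂) (i₃ := i₃) (k := k)
      (x := -1) (y := β / (c * α - β)) (neg_ne_zero.2 one_ne_zero)
      (div_ne_zero hβ hd) hxy
      (fun h => h12 (by rw [h])) (fun h => h13 (by rw [h]))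
      (by
        rw [Function.update_self, hb0, hbk]
        convert (P i₂).submodule.smul_mem (-c) (rep_mem (P i₂)) using 1
        module)
      (by
        rw [Function.update_self, hb0, hbk]
        convert (P i₃).submodule.smul_mem (c / (c * α - β)) (rep_mem (P i₃)) using 1
        rw [← h3']
        match_scalars <;> field_simp
        ring)
    omega

/-! ### Configurations of three collinear points and a spanning set -/

/-- A configuration of `n + 4` points of `n`-dimensional projective space, `n = N + 2`: three points
on a line `l`, and `n + 1` points off `l` spanning the space, such that the first three of the
latter span a plane containing `l`. -/
structure IsConfig {N : ℕ} (P : Fin (N + 2 + 4) → PSpace K (N + 2))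
    (α l : Submodule K (Fin (N + 2 + 1) → K)) : Prop where
  injective : Function.Injective P
  finrank_plane : finrank K α = 3
  finrank_line : finrank K l = 2
  line_le : l ≤ α
  le_line : ∀ i, i.val < 3 → (P i).submodule ≤ l
  not_le_line : ∀ k : Fin (N + 2 + 1), ¬ (P (k.addNat 3)).submodule ≤ l
  le_plane : ∀ k : Fin (N + 2 + 1), k.val < 3 → (P (k.addNat 3)).submodule ≤ α
  span_eq : ⨆ k : Fin (N + 2 + 1), (P (k.addNat 3)).submodule = ⊤

-- `simp` turns the value of the numeral `2 : Fin (N + 2 + 1)` into `2 % (N + 2 + 1)`.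
@[simp]
theorem two_mod_add_two_add_one (N : ℕ) : 2 % (N + 2 + 1) = 2 := Nat.mod_eq_of_lt (by omega)

@[simp]
theorem two_mod_add_two_add_four (N : ℕ) : 2 % (N + 2 + 4) = 2 := Nat.mod_eq_of_lt (by omega)

theorem eq_zero_or_one_or_two {N : ℕ} {i : Fin (N + 2 + 4)} (hi : i.val < 3) :
    i = 0 ∨ i = 1 ∨ i = 2 := by
  simp only [Fin.ext_iff, Fin.val_zero, Fin.val_one, Fin.val_two]
  omega

theorem exists_addNat {N : ℕ} {i : Fin (N + 2 + 4)} (hi : 3 ≤ i.val) :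
    ∃ k : Fin (N + 2 + 1), i = k.addNat 3 :=
  ⟨⟨i.val - 3, by omega⟩, Fin.ext (by simp; omega)⟩

/-- If two functionals are jointly injective on a subspace, then their determinant on a linearly
independent pair of its vectors does not vanish. -/
theorem mul_sub_mul_ne_zero {V : Type*} [AddCommGroup V] [Module K V] {l : Submodule K V}
    {f g : Dual K V} (h : ∀ v ∈ l, f v = 0 → g v = 0 → v = 0) {p u : V} (hp : p ∈ l) (hu : u ∈ l)
    (hpu : LinearIndependent K ![p, u]) : f p * g u - g p * f u ≠ 0 := by
  intro h0
  rw [LinearIndependent.pair_iff] at hpu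
  have h1 := hpu (f u) (-f p) (by
    rw [neg_smul, ← sub_eq_add_neg]
    refine h _ (l.sub_mem (l.smul_mem _ hp) (l.smul_mem _ hu)) ?_ ?_
    · simp only [map_sub, map_smul, smul_eq_mul]; ring
    · simp only [map_sub, map_smul, smul_eq_mul]; linear_combination -h0)
  have h2 := hpu (g u) (-g p) (by
    rw [neg_smul, ← sub_eq_add_neg]
    refine h _ (l.sub_mem (l.smul_mem _ hp) (l.smul_mem _ hu)) ?_ ?_
    · simp only [map_sub, map_smul, smul_eq_mul]; linear_combination h0
    · simp only [map_sub, map_smul, smul_eq_mul]; ring)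
  have hu0 := h u hu h1.1 h2.1
  exact one_ne_zero (hpu 0 1 (by simp [hu0])).2

namespace IsConfig

variable {N : ℕ} {P : Fin (N + 2 + 4) → PSpace K (N + 2)}
  {α l : Submodule K (Fin (N + 2 + 1) → K)}

theorem span_rep_eq (h : IsConfig P α l) :
    ⊤ ≤ Submodule.span K (Set.range fun k : Fin (N + 2 + 1) => (P (k.addNat 3)).rep) := by
  rw [← h.span_eq, iSup_le_iff]
  intro k
  rw [submodule_le_iff]
  exact Submodule.subset_span ⟨k, rfl⟩

/-- The basis of `K ^ (n + 1)` given by the spanning points of a configuration. -/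
def basis (h : IsConfig P α l) : Basis (Fin (N + 2 + 1)) K (Fin (N + 2 + 1) → K) :=
  basisOfTopLeSpanOfCardEqFinrank _ h.span_rep_eq (by simp)

theorem basis_apply (h : IsConfig P α l) (k : Fin (N + 2 + 1)) :
    h.basis k = (P (k.addNat 3)).rep := by
  simp [basis]

theorem basis_notMem (h : IsConfig P α l) (k : Fin (N + 2 + 1)) : h.basis k ∉ l := by
  rw [basis_apply, ← submodule_le_iff]; exact h.not_le_line k

theorem basis_mem (h : IsConfig P α l) {k : Fin (N + 2 + 1)} (hk : k.val < 3) : h.basis k ∈ α := by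
  rw [basis_apply, ← submodule_le_iff]; exact h.le_plane k hk

theorem rep_mem_line (h : IsConfig P α l) {i : Fin (N + 2 + 4)} (hi : i.val < 3) :
    (P i).rep ∈ l :=
  (submodule_le_iff _ _).1 (h.le_line i hi)

theorem plane_eq (h : IsConfig P α l) :
    Submodule.span K (Set.range ![h.basis 0, h.basis 1, h.basis 2]) = α := by
  apply Submodule.eq_of_le_of_finrank_eq
  · rw [Submodule.span_le]
    rintro _ ⟨i, rfl⟩
    fin_cases i
    exacts [h.basis_mem (by simp), h.basis_mem (by simp), h.basis_mem (by simp)]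
  · have hli : LinearIndependent K (h.basis ∘ (![0, 1, 2] : Fin 3 → Fin (N + 2 + 1))) := by
      refine h.basis.linearIndependent.comp _ fun i j hij => ?_
      fin_cases i <;> fin_cases j <;> simp [Fin.ext_iff] at hij ⊢
    have e : h.basis ∘ (![0, 1, 2] : Fin 3 → Fin (N + 2 + 1)) =
        ![h.basis 0, h.basis 1, h.basis 2] := by
      ext i : 1
      fin_cases i <;> rfl
    rw [e] at hli
    rw [finrank_span_eq_card hli, h.finrank_plane, Fintype.card_fin]

theorem coord_eq_zero (h : IsConfig P α l) {v : Fin (N + 2 + 1) → K} (hv : v ∈ α)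
    {k : Fin (N + 2 + 1)} (hk : 3 ≤ k.val) : h.basis.coord k v = 0 := by
  have hle : α ≤ LinearMap.ker (h.basis.coord k) := by
    refine h.plane_eq.ge.trans (Submodule.span_le.2 ?_)
    rintro _ ⟨i, rfl⟩
    have hne : ∀ j : Fin (N + 2 + 1), j.val < 3 → h.basis.coord k (h.basis j) = 0 := by
      intro j hj
      have hjk : j ≠ k := fun e => by rw [e] at hj; omega
      simp [hjk]
    fin_cases i
    exacts [hne 0 (by simp), hne 1 (by simp), hne 2 (by simp)]
  exact hle hv

theorem eq_sum_coord (h : IsConfig P α l) {v : Fin (N + 2 + 1) → K} (hv : v ∈ α) :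
    v = h.basis.coord 0 v • h.basis 0 + h.basis.coord 1 v • h.basis 1 +
      h.basis.coord 2 v • h.basis 2 := by
  conv_lhs => rw [← h.basis.sum_repr v]
  rw [Fin.sum_univ_succ, Fin.sum_univ_succ, Fin.sum_univ_succ, Finset.sum_eq_zero, add_zero,
    ← add_assoc]
  · rfl
  · intro k _
    have := h.coord_eq_zero hv (k := k.succ.succ.succ) (by simp)
    rw [Basis.coord_apply] at this
    rw [this, zero_smul]

/-- A linear functional cutting out the line `l` in the plane `α`. -/
theorem exists_dual (h : IsConfig P α l) : ∃ a : Dual K (Fin (N + 2 + 1) → K),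
    (∀ v ∈ l, a v = 0) ∧ ∀ k, k.val < 3 → a (h.basis k) ≠ 0 := by
  obtain ⟨a', ha', hl⟩ := Submodule.exists_le_ker_of_notMem (h.basis_notMem 0)
  refine ⟨a', fun v hv => hl hv, fun k hk h0 => ?_⟩
  -- otherwise `a'` would vanish on the plane spanned by `l` and the `k`-th basis vector
  have hlt : l < l ⊔ K ∙ h.basis k := by
    refine lt_of_le_of_ne le_sup_left fun e => h.basis_notMem k ?_
    exact e.ge (Submodule.mem_sup_right (Submodule.mem_span_singleton_self _))
  have hle : l ⊔ K ∙ h.basis k ≤ α :=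
    sup_le h.line_le ((Submodule.span_singleton_le_iff_mem _ _).2 (h.basis_mem hk))
  have heq : l ⊔ K ∙ h.basis k = α := by
    apply Submodule.eq_of_le_of_finrank_le hle
    have := Submodule.finrank_lt_finrank_of_lt hlt
    rw [h.finrank_line] at this
    rw [h.finrank_plane]
    omega
  have hker : α ≤ LinearMap.ker a' := by
    rw [← heq]
    exact sup_le hl ((Submodule.span_singleton_le_iff_mem _ _).2 h0)
  exact ha' (hker (h.basis_mem (by simp)))

/-- The third coordinate of the plane, together with either of the two others, is injective on the
line `l`, since the basis vectors do not lie on `l`. -/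
theorem eq_zero_of_coord_eq_zero (h : IsConfig P α l) {v : Fin (N + 2 + 1) → K} (hv : v ∈ l)
    (h2 : h.basis.coord 2 v = 0) (h01 : h.basis.coord 0 v = 0 ∨ h.basis.coord 1 v = 0) : v = 0 := by
  have hz : ∀ {c : K} {k : Fin (N + 2 + 1)}, v = c • h.basis k → v = 0 := fun {c k} hc => by
    by_cases hc0 : c = 0
    · rw [hc, hc0, zero_smul]
    · exact absurd ((l.smul_mem_iff hc0).1 (hc ▸ hv)) (h.basis_notMem k)
  have e := h.eq_sum_coord (h.line_le hv)
  rcases h01 with h0 | h1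
  · rw [h2, h0, zero_smul, zero_smul, zero_add, add_zero] at e
    exact hz e
  · rw [h2, h1, zero_smul, zero_smul, add_zero, add_zero] at e
    exact hz e

/-- A quadric separating one of the three collinear points from all other points. Its
trace on the plane is the conic through the third basis point in the pencil of conics through the
first two basis points and the two other collinear points; two members of the pencil are pairs of
lines. It contains all basis points off the plane. -/
theorem exists_quadric_of_lt (h : IsConfig P α l) {i j k : Fin (N + 2 + 4)} (hi : i.val < 3)
    (hj : j.val < 3) (hk : k.val < 3) (hij : i ≠ j) (hik : i ≠ k) (hjk : j ≠ k) :
    ∃ q : MvPolynomial (Fin (N + 2 + 1)) K, q.IsHomogeneous 2 ∧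
      (∀ i', i' ≠ i → eval (P i').rep q = 0) ∧ eval (P i).rep q ≠ 0 := by
  obtain ⟨a, hal, hak⟩ := h.exists_dual
  set x := h.basis.coord with hx
  set p := (P j).rep with hp
  set r := (P k).rep with hr
  have hpl : p ∈ l := h.rep_mem_line hj
  have hrl : r ∈ l := h.rep_mem_line hk
  have hul : (P i).rep ∈ l := h.rep_mem_line hi
  refine ⟨C (a (h.basis 2)) * (linForm (x 2 p • x 1 - x 1 p • x 2) *
    linForm (x 2 r • x 0 - x 0 r • x 2)) - C (x 1 p * x 0 r) * (linForm a * linForm (x 2)),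
    ?_, ?_, ?_⟩
  · exact (((linForm_isHomogeneous _).mul (linForm_isHomogeneous _)).C_mul _).sub
      (((linForm_isHomogeneous _).mul (linForm_isHomogeneous _)).C_mul _)
  · intro i' hi'
    simp only [map_sub, map_mul, eval_C, eval_linForm, LinearMap.smul_apply,
      smul_eq_mul]
    rcases lt_or_ge i'.val 3 with hlt | hge
    · rw [hal _ (h.rep_mem_line hlt)]
      have : i' = j ∨ i' = k := by
        simp only [Fin.ext_iff, ne_eq] at *
        omega
      rcases this with rfl | rfl
      · rw [← hp]; ring
      · rw [← hr]; ring
    · obtain ⟨b, rfl⟩ := exists_addNat hge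
      rw [← h.basis_apply]
      have hxb : ∀ c, x c (h.basis b) = if b = c then 1 else 0 := fun c => by
        simp [hx, Finsupp.single_apply]
      by_cases hb2 : b = 2
      · subst hb2
        rw [hxb, hxb, hxb, if_pos rfl, if_neg (by simp [Fin.ext_iff]),
          if_neg (by simp [Fin.ext_iff])]
        ring
      · rw [hxb 2, if_neg hb2]
        by_cases hb1 : b = 1
        · rw [hxb 0, if_neg (by simp [hb1])]
          ring
        · rw [hxb 1, if_neg hb1]
          ring
  · simp only [map_sub, map_mul, eval_C, eval_linForm, LinearMap.smul_apply,
      smul_eq_mul]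
    rw [hal _ hul, zero_mul, mul_zero, sub_zero]
    refine mul_ne_zero (hak 2 (by simp)) (mul_ne_zero ?_ ?_)
    · exact mul_sub_mul_ne_zero (fun v hv h2 h1 => h.eq_zero_of_coord_eq_zero hv h2 (Or.inr h1))
        hpl hul (linearIndependent_rep_pair fun e => hij (h.injective e).symm)
    · exact mul_sub_mul_ne_zero (fun v hv h2 h0 => h.eq_zero_of_coord_eq_zero hv h2 (Or.inl h0))
        hrl hul (linearIndependent_rep_pair fun e => hik (h.injective e).symm)

/-- A quadric, in fact a pair of hyperplanes, separating a basis point from all others. -/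
theorem exists_quadric_addNat (h : IsConfig P α l) (k : Fin (N + 2 + 1)) :
    ∃ q : MvPolynomial (Fin (N + 2 + 1)) K, q.IsHomogeneous 2 ∧
      (∀ i', i' ≠ k.addNat 3 → eval (P i').rep q = 0) ∧ eval (P (k.addNat 3)).rep q ≠ 0 := by
  obtain ⟨a, hal, hak⟩ := h.exists_dual
  have hself : h.basis.coord k (h.basis k) = 1 := by simp
  have hother : ∀ b, b ≠ k → h.basis.coord k (h.basis b) = 0 := fun b hb => by
    simp [hb]
  have key : ∀ c : Dual K (Fin (N + 2 + 1) → K), c (h.basis k) ≠ 0 →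
      (∀ i : Fin (N + 2 + 4), i.val < 3 → c (P i).rep = 0) →
      ∃ q : MvPolynomial (Fin (N + 2 + 1)) K, q.IsHomogeneous 2 ∧
        (∀ i', i' ≠ k.addNat 3 → eval (P i').rep q = 0) ∧ eval (P (k.addNat 3)).rep q ≠ 0 := by
    intro c hck hc
    refine ⟨linForm c * linForm (h.basis.coord k),
      (linForm_isHomogeneous _).mul (linForm_isHomogeneous _), fun i hi => ?_, ?_⟩
    · rw [map_mul, eval_linForm, eval_linForm]
      rcases lt_or_ge i.val 3 with hlt | hge
      · rw [hc i hlt, zero_mul]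
      · obtain ⟨b, rfl⟩ := exists_addNat hge
        rw [← h.basis_apply, hother b fun e => hi (by rw [e]), mul_zero]
    · rw [map_mul, eval_linForm, eval_linForm, ← h.basis_apply, hself, mul_one]
      exact hck
  rcases lt_or_ge k.val 3 with hk | hk
  · exact key a (hak k hk) fun i hi => hal _ (h.rep_mem_line hi)
  · exact key (h.basis.coord k) (by rw [hself]; exact one_ne_zero)
      fun i hi => h.coord_eq_zero (h.line_le (h.rep_mem_line hi)) hk

theorem exists_quadric (h : IsConfig P α l) (i : Fin (N + 2 + 4)) :
    ∃ q : MvPolynomial (Fin (N + 2 + 1)) K, q.IsHomogeneous 2 ∧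
      (∀ j, j ≠ i → eval (P j).rep q = 0) ∧ eval (P i).rep q ≠ 0 := by
  rcases lt_or_ge i.val 3 with hi | hi
  · rcases eq_zero_or_one_or_two hi with rfl | rfl | rfl
    · exact h.exists_quadric_of_lt (j := 1) (k := 2) (by simp) (by simp) (by simp)
        (by simp) (by simp [Fin.ext_iff]) (by simp [Fin.ext_iff])
    · exact h.exists_quadric_of_lt (j := 0) (k := 2) (by simp) (by simp) (by simp)
        (by simp) (by simp [Fin.ext_iff]) (by simp [Fin.ext_iff])
    · exact h.exists_quadric_of_lt (j := 0) (k := 1) (by simp) (by simp) (by simp)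
        (by simp [Fin.ext_iff]) (by simp [Fin.ext_iff]) (by simp)
  · obtain ⟨k, rfl⟩ := exists_addNat hi
    exact h.exists_quadric_addNat k

theorem regIndex_eq [Infinite K] (h : IsConfig P α l) {m : ℕ} (hm : 1 ≤ m) :
    regIndex P (fun _ => m) = 3 * m - 1 :=
  regIndex_eq_three_mul_sub_one (by omega) hm h.exists_quadric h.finrank_line
    (i₁ := 0) (i₂ := 1) (i₃ := 2)
    (h.injective.ne (by simp)) (h.injective.ne (by simp [Fin.ext_iff]))
    (h.injective.ne (by simp [Fin.ext_iff]))
    (h.le_line 0 (by simp)) (h.le_line 1 (by simp)) (h.le_line 2 (by simp))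

/-! ### Segre's bound of a configuration -/

theorem card_filter_le_finrank (h : IsConfig P α l) {L : Submodule K (Fin (N + 2 + 1) → K)}
    {S : Finset (Fin (N + 2 + 4))} (hS : ∀ i ∈ S, (P i).submodule ≤ L) :
    (S.filter fun i => 3 ≤ i.val).card ≤ finrank K L := by
  classical
  set D := S.filter fun i => 3 ≤ i.val with hD
  choose! k hk using fun (i : Fin (N + 2 + 4)) (hi : 3 ≤ i.val) => exists_addNat hi
  have hrep : ∀ i : D, h.basis (k i) = (P i).rep := fun i => by
    rw [h.basis_apply, ← hk i (Finset.mem_filter.1 i.2).2]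
  have hli : LinearIndependent K (fun i : D => h.basis (k i)) := by
    refine h.basis.linearIndependent.comp (fun i : D => k i) fun i j hij => ?_
    have hij' : k i = k j := hij
    apply Subtype.ext
    rw [hk i (Finset.mem_filter.1 i.2).2, hk j (Finset.mem_filter.1 j.2).2, hij']
  have hmem : ∀ i : D, h.basis (k i) ∈ L := fun i => by
    rw [hrep, ← submodule_le_iff]
    exact hS i (Finset.mem_filter.1 i.2).1
  have hli' : LinearIndependent K (fun i : D => (⟨h.basis (k i), hmem i⟩ : L)) :=
    LinearIndependent.of_comp L.subtype hli
  simpa using hli'.fintype_card_le_finrank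

theorem card_filter_lt_le (S : Finset (Fin (N + 2 + 4))) :
    (S.filter fun i => i.val < 3).card ≤ 3 := by
  have hsub : (S.filter fun i => i.val < 3) ⊆ {0, 1, 2} := by
    intro i hi
    have := (Finset.mem_filter.1 hi).2
    simp only [Finset.mem_insert, Finset.mem_singleton, Fin.ext_iff, Fin.val_zero, Fin.val_one,
      Fin.val_two]
    omega
  exact (Finset.card_le_card hsub).trans Finset.card_le_three

theorem card_eq_filter_add_filter (S : Finset (Fin (N + 2 + 4))) :
    S.card = (S.filter fun i => i.val < 3).card + (S.filter fun i => 3 ≤ i.val).card := by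
  rw [← Finset.card_filter_add_card_filter_not (fun i : Fin (N + 2 + 4) => i.val < 3)]
  simp only [not_lt]

theorem card_le_of_lieOnLinearSubspace (h : IsConfig P α l) {j : ℕ}
    {S : Finset (Fin (N + 2 + 4))} (hS : LieOnLinearSubspace P j S) : S.card ≤ j + 4 := by
  obtain ⟨L, hL, hSL⟩ := hS
  have h1 := h.card_filter_le_finrank hSL
  have h2 := card_filter_lt_le S
  rw [card_eq_filter_add_filter S]
  omega

/-- At most three points of a configuration are collinear. -/
theorem card_le_three_of_lieOnLinearSubspace_one (h : IsConfig P α l)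
    {S : Finset (Fin (N + 2 + 4))} (hS : LieOnLinearSubspace P 1 S) : S.card ≤ 3 := by
  obtain ⟨L, hL, hSL⟩ := hS
  have h1 := h.card_filter_le_finrank hSL
  have h2 := card_filter_lt_le S
  rw [card_eq_filter_add_filter S]
  rcases Nat.lt_or_ge 1 (S.filter fun i => i.val < 3).card with hlt | hge
  · -- two points of `S` lie on `l`, whence the line containing `S` is `l`
    obtain ⟨i, hi, j, hj, hij⟩ := Finset.one_lt_card.1 hlt
    rw [Finset.mem_filter] at hi hj
    have hne := h.injective.ne hij
    have e : L = l := (eq_span_rep_pair hne hL (hSL i hi.1) (hSL j hj.1)).symm.trans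
      (eq_span_rep_pair hne h.finrank_line (h.le_line i hi.2) (h.le_line j hj.2))
    have h0 : (S.filter fun i => 3 ≤ i.val) = ∅ := by
      refine Finset.filter_eq_empty_iff.2 fun {b} hb hb3 => ?_
      obtain ⟨k, rfl⟩ := exists_addNat hb3
      exact h.not_le_line k (e ▸ hSL _ hb)
    rw [h0, Finset.card_empty]
    omega
  · omega

theorem segreT_one (h : IsConfig P α l) (m : ℕ) : segreT P (fun _ => m) 1 = 3 * m - 1 := by
  classical
  apply le_antisymm
  · refine Finset.sup_le fun S hS => ?_
    have hc := h.card_le_three_of_lieOnLinearSubspace_one (Finset.mem_filter.1 hS).2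
    have := Nat.mul_le_mul_right m hc
    simp only [Finset.sum_const, smul_eq_mul, Nat.div_one]
    omega
  · have hS : LieOnLinearSubspace P 1 {0, 1, 2} := by
      refine ⟨l, h.finrank_line, fun i hi => h.le_line i ?_⟩
      simp only [Finset.mem_insert, Finset.mem_singleton] at hi
      rcases hi with rfl | rfl | rfl <;> simp
    refine le_trans ?_ (Finset.le_sup (Finset.mem_filter.2 ⟨Finset.mem_univ _, hS⟩))
    have hcard : ({0, 1, 2} : Finset (Fin (N + 2 + 4))).card = 3 :=
      Finset.card_eq_three.2 ⟨0, 1, 2, by simp, by simp [Fin.ext_iff],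
        by simp [Fin.ext_iff], rfl⟩
    simp only [Finset.sum_const, smul_eq_mul, Nat.div_one, hcard]
    omega

theorem segreT_le (h : IsConfig P α l) (m : ℕ) {j : ℕ} (hj : 2 ≤ j) :
    segreT P (fun _ => m) j ≤ 3 * m := by
  classical
  refine Finset.sup_le fun S hS => ?_
  have hc := h.card_le_of_lieOnLinearSubspace (Finset.mem_filter.1 hS).2
  have h1 := Nat.mul_le_mul_right m hc
  have h2 := Nat.mul_le_mul_right m hj
  simp only [Finset.sum_const, smul_eq_mul]
  -- `(j + 4) * m + j - 2 < (3 * m + 1) * j`, as `4 * m ≤ 2 * j * m`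
  rw [← Nat.lt_succ_iff, Nat.div_lt_iff_lt_mul (by omega)]
  have e1 : (j + 4) * m = j * m + 4 * m := by ring
  have e2 : (3 * m + 1) * j = 3 * (j * m) + j := by ring
  rw [Nat.succ_eq_add_one, e2]
  omega

theorem segreT_two (h : IsConfig P α l) (m : ℕ) : segreT P (fun _ => m) 2 = 3 * m := by
  classical
  apply le_antisymm (h.segreT_le m le_rfl)
  have hS : LieOnLinearSubspace P 2 (Finset.univ.filter fun i => i.val < 6) := by
    refine ⟨α, h.finrank_plane, fun i hi => ?_⟩
    have hi := (Finset.mem_filter.1 hi).2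
    rcases lt_or_ge i.val 3 with hlt | hge
    · exact (h.le_line i hlt).trans h.line_le
    · obtain ⟨k, rfl⟩ := exists_addNat hge
      refine h.le_plane k ?_
      rw [Fin.val_addNat] at hi
      omega
  refine le_trans ?_ (Finset.le_sup (Finset.mem_filter.2 ⟨Finset.mem_univ _, hS⟩))
  have hcard : (Finset.univ.filter fun i : Fin (N + 2 + 4) => i.val < 6).card = 6 := by
    rw [Fin.card_filter_val_lt]
    omega
  simp only [Finset.sum_const, smul_eq_mul, hcard]
  omega

theorem segreBound_eq (h : IsConfig P α l) (m : ℕ) : segreBound P (fun _ => m) = 3 * m := by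
  apply le_antisymm
  · refine Finset.sup_le fun j hj => ?_
    rcases (Finset.mem_Icc.1 hj).1.eq_or_lt with rfl | hlt
    · rw [h.segreT_one]; omega
    · exact h.segreT_le m hlt
  · rw [← h.segreT_two m]
    exact Finset.le_sup (f := segreT P fun _ => m) (Finset.mem_Icc.2 (by omega))

theorem nondegenerate (h : IsConfig P α l) : Nondegenerate P := by
  rw [Nondegenerate, eq_top_iff, ← h.span_eq, iSup_le_iff]
  exact fun k => le_iSup (fun i => (P i).submodule) (k.addNat 3)

end IsConfig

/-! ### The two families of configurations -/

/-- A planar six-point configuration has its last three points spanning the plane. -/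
theorem IsPlanarSix.exists_isConfig {Q : Fin 6 → PSpace K 2} (h : IsPlanarSix Q) :
    ∃ α l, IsConfig (N := 0) Q α l := by
  obtain ⟨hinj, α, l₁, l₂, hα, hl₁, hl₂, h1α, h2α, -, h123, h45, h6α, h61, h62⟩ := h
  refine ⟨α, l₁, hinj, hα, hl₁, h1α, fun i hi => (h123 i hi).1, ?_, ?_, ?_⟩
  · intro k
    fin_cases k
    exacts [(h45 3 (by decide) (by decide)).2, (h45 4 (by decide) (by decide)).2, h61]
  · intro k _
    fin_cases k
    exacts [(h45 3 (by decide) (by decide)).1.trans h2α,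
      (h45 4 (by decide) (by decide)).1.trans h2α, h6α]
  · have hle : ∀ k : Fin 3, (Q (k.addNat 3)).submodule ≤
        ⨆ k : Fin 3, (Q (k.addNat 3)).submodule :=
      fun k => le_iSup (fun k : Fin 3 => (Q (k.addNat 3)).submodule) k
    have h2 : l₂ ≤ ⨆ k : Fin 3, (Q (k.addNat 3)).submodule := by
      rw [← eq_span_rep_pair (P := Q 3) (Q := Q 4) (hinj.ne (by decide)) hl₂
        (h45 3 (by decide) (by decide)).1 (h45 4 (by decide) (by decide)).1, Submodule.span_le]
      rintro _ (rfl | rfl)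
      · exact hle 0 (rep_mem _)
      · exact hle 1 (rep_mem _)
    have hlt : l₂ < ⨆ k : Fin 3, (Q (k.addNat 3)).submodule :=
      lt_of_le_of_ne h2 fun e => h62 ((hle 2).trans e.ge)
    have h3 := Submodule.finrank_lt_finrank_of_lt hlt
    rw [hl₂] at h3
    apply Submodule.eq_top_of_finrank_eq
    apply le_antisymm (Submodule.finrank_le _)
    rw [finrank_fin_fun]
    exact h3

theorem IsConfig.nondegenerate_subtype {N : ℕ} {P : Fin (N + 2 + 4) → PSpace K (N + 2)}
    {α l : Submodule K (Fin (N + 2 + 1) → K)} (h : IsConfig P α l) :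
    Nondegenerate (fun i : {i : Fin (N + 2 + 4) // 3 ≤ i.val} => P i) := by
  rw [Nondegenerate, eq_top_iff, ← h.span_eq, iSup_le_iff]
  exact fun k => le_iSup (fun i : {i : Fin (N + 2 + 4) // 3 ≤ i.val} => (P i).submodule)
    ⟨k.addNat 3, by simp⟩

/-- The standard basis vectors of `K ^ (n + 1)`, `n = N + 2`, preceded by three vectors
`x` in the span of the first three of them with `x_0 + x_1 + x_2 = 0`. For `d ≠ 0` these three are
pairwise non-proportional, for `d ≠ -1` none of them has `x_2 = 0`. -/
def configVec (N : ℕ) (d : K) (i : Fin (N + 2 + 4)) : Fin (N + 2 + 1) → K :=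
  if i.val = 0 then Pi.single 0 1 - Pi.single 2 1
  else if i.val = 1 then Pi.single 1 1 - Pi.single 2 1
  else if i.val = 2 then Pi.single 0 1 + d • Pi.single 1 1 - (1 + d) • Pi.single 2 1
  else Pi.single ⟨i.val - 3, by omega⟩ 1

variable {N : ℕ} {d : K}

theorem configVec_zero : configVec N d 0 = Pi.single 0 1 - Pi.single 2 1 := by
  simp [configVec]

theorem configVec_one : configVec N d 1 = Pi.single 1 1 - Pi.single 2 1 := by
  simp [configVec]

theorem configVec_two :
    configVec N d 2 = Pi.single 0 1 + d • Pi.single 1 1 - (1 + d) • Pi.single 2 1 := by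
  simp [configVec]

theorem configVec_addNat (k : Fin (N + 2 + 1)) :
    configVec N d (k.addNat 3) = Pi.single k 1 := by
  simp [configVec]

theorem configVec_ne_zero (i : Fin (N + 2 + 4)) : configVec N d i ≠ 0 := by
  intro h
  rcases lt_or_ge i.val 3 with hi | hi
  · rcases eq_zero_or_one_or_two hi with rfl | rfl | rfl
    · have := congrFun h 0
      simp [configVec_zero, Fin.ext_iff] at this
    · have := congrFun h 1
      simp [configVec_one, Fin.ext_iff] at this
    · have := congrFun h 0
      simp [configVec_two, Fin.ext_iff] at this
  · obtain ⟨k, rfl⟩ := exists_addNat hi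
    have := congrFun h k
    simp [configVec_addNat] at this

/-- The points of projective `n`-space, `n = N + 2`, with coordinates `configVec N d`. -/
def configPt (N : ℕ) (d : K) (i : Fin (N + 2 + 4)) : PSpace K (N + 2) :=
  Projectivization.mk K (configVec N d i) (configVec_ne_zero i)

/-- The line containing the first three points of `configPt`. -/
def configLine (K : Type*) [Field K] (N : ℕ) : Submodule K (Fin (N + 2 + 1) → K) :=
  Submodule.span K (Set.range ![Pi.single 0 1 - Pi.single 2 1, Pi.single 1 1 - Pi.single 2 1])

/-- The line `x_2 = 0` in the plane of the first three coordinates. -/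
def coordLine (K : Type*) [Field K] (N : ℕ) : Submodule K (Fin (N + 2 + 1) → K) :=
  Submodule.span K (Set.range ![Pi.single 0 1, Pi.single 1 1])

/-- The plane of the first three coordinates. -/
def coordPlane (K : Type*) [Field K] (N : ℕ) : Submodule K (Fin (N + 2 + 1) → K) :=
  Submodule.span K (Set.range ![Pi.single 0 1, Pi.single 1 1, Pi.single 2 1])

theorem configPt_le_iff {i : Fin (N + 2 + 4)} {L : Submodule K (Fin (N + 2 + 1) → K)} :
    (configPt N d i).submodule ≤ L ↔ configVec N d i ∈ L := by
  rw [configPt, Projectivization.submodule_mk, Submodule.span_singleton_le_iff_mem]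

theorem finrank_configLine : finrank K (configLine K N) = 2 := by
  rw [configLine, finrank_span_eq_card, Fintype.card_fin]
  rw [LinearIndependent.pair_iff]
  intro x y hxy
  have h0 := congrFun hxy 0
  have h1 := congrFun hxy 1
  simp [Fin.ext_iff] at h0 h1
  exact ⟨h0, h1⟩

theorem finrank_coordLine : finrank K (coordLine K N) = 2 := by
  rw [coordLine, finrank_span_eq_card, Fintype.card_fin]
  rw [LinearIndependent.pair_iff]
  intro x y hxy
  have h0 := congrFun hxy 0
  have h1 := congrFun hxy 1
  simp at h0 h1
  exact ⟨h0, h1⟩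

theorem finrank_coordPlane : finrank K (coordPlane K N) = 3 := by
  rw [coordPlane, finrank_span_eq_card, Fintype.card_fin]
  rw [Fintype.linearIndependent_iff]
  intro g hg
  have h0 := congrFun hg 0
  have h1 := congrFun hg 1
  have h2 := congrFun hg 2
  simp [Fin.sum_univ_three, Fin.ext_iff] at h0 h1 h2
  intro i
  fin_cases i
  exacts [h0, h1, h2]

theorem single_mem_coordPlane {k : Fin (N + 2 + 1)} (hk : k.val < 3) :
    Pi.single k 1 ∈ coordPlane K N := by
  have : k = 0 ∨ k = 1 ∨ k = 2 := by
    simp only [Fin.ext_iff, Fin.val_zero, Fin.val_one, Fin.val_two]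
    omega
  rcases this with rfl | rfl | rfl
  exacts [Submodule.subset_span ⟨0, rfl⟩, Submodule.subset_span ⟨1, rfl⟩,
    Submodule.subset_span ⟨2, rfl⟩]

theorem configLine_le : configLine K N ≤ coordPlane K N := by
  rw [configLine, Submodule.span_le]
  rintro _ ⟨i, rfl⟩
  fin_cases i
  · exact sub_mem (single_mem_coordPlane (by simp)) (single_mem_coordPlane (by simp))
  · exact sub_mem (single_mem_coordPlane (by simp)) (single_mem_coordPlane (by simp))

theorem coordLine_le : coordLine K N ≤ coordPlane K N := by
  rw [coordLine, Submodule.span_le]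
  rintro _ ⟨i, rfl⟩
  fin_cases i
  · exact single_mem_coordPlane (by simp)
  · exact single_mem_coordPlane (by simp)

theorem configVec_mem_configLine {i : Fin (N + 2 + 4)} (hi : i.val < 3) :
    configVec N d i ∈ configLine K N := by
  have h0 : configVec N d 0 ∈ configLine K N := by
    rw [configVec_zero]; exact Submodule.subset_span ⟨0, rfl⟩
  have h1 : configVec N d 1 ∈ configLine K N := by
    rw [configVec_one]; exact Submodule.subset_span ⟨1, rfl⟩
  rcases eq_zero_or_one_or_two hi with rfl | rfl | rfl
  · exact h0
  · exact h1
  · convert add_mem h0 (Submodule.smul_mem _ d h1) using 1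
    rw [configVec_zero, configVec_one, configVec_two]
    module

theorem sum_eq_zero_of_mem_configLine {v : Fin (N + 2 + 1) → K} (hv : v ∈ configLine K N) :
    ∑ k, v k = 0 := by
  have hle : configLine K N ≤ LinearMap.ker (∑ k, LinearMap.proj k : Dual K _) := by
    rw [configLine, Submodule.span_le]
    rintro _ ⟨i, rfl⟩
    fin_cases i <;> simp
  simpa using hle hv

theorem single_notMem_configLine (k : Fin (N + 2 + 1)) : Pi.single k 1 ∉ configLine K N := by
  intro h
  have := sum_eq_zero_of_mem_configLine h
  simp at this

theorem apply_two_eq_zero_of_mem_coordLine {v : Fin (N + 2 + 1) → K} (hv : v ∈ coordLine K N) :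
    v 2 = 0 := by
  have hle : coordLine K N ≤ LinearMap.ker (LinearMap.proj 2 : Dual K (Fin (N + 2 + 1) → K)) := by
    rw [coordLine, Submodule.span_le]
    rintro _ ⟨i, rfl⟩
    fin_cases i <;> simp [Fin.ext_iff]
  simpa using hle hv

theorem configVec_notMem_coordLine (hd : 1 + d ≠ 0) {i : Fin (N + 2 + 4)} (hi : i.val < 3) :
    configVec N d i ∉ coordLine K N := by
  intro h
  have := apply_two_eq_zero_of_mem_coordLine h
  rcases eq_zero_or_one_or_two hi with rfl | rfl | rfl
  · simp [configVec_zero, Fin.ext_iff] at this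
  · simp [configVec_one, Fin.ext_iff] at this
  · simp [configVec_two, Fin.ext_iff] at this
    exact hd (by linear_combination -this)

theorem configPt_injective (hd : d ≠ 0) : Function.Injective (configPt N d) := by
  have h01 : configPt N d 0 ≠ configPt N d 1 := by
    rw [configPt, configPt, Ne, Projectivization.mk_eq_mk_iff']
    rintro ⟨a, ha⟩
    have := congrFun ha 0
    simp [configVec_zero, configVec_one, Fin.ext_iff] at this
  have h02 : configPt N d 0 ≠ configPt N d 2 := by
    rw [configPt, configPt, Ne, Projectivization.mk_eq_mk_iff']
    rintro ⟨a, ha⟩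
    have h0 := congrFun ha 0
    have h1 := congrFun ha 1
    simp [configVec_zero, configVec_two, Fin.ext_iff, hd] at h0 h1
    exact one_ne_zero (h0.symm.trans h1)
  have h12 : configPt N d 1 ≠ configPt N d 2 := by
    rw [configPt, configPt, Ne, Projectivization.mk_eq_mk_iff']
    rintro ⟨a, ha⟩
    have h0 := congrFun ha 0
    have h1 := congrFun ha 1
    simp [configVec_one, configVec_two, Fin.ext_iff] at h0 h1
    simp [h0] at h1
  have hlt : ∀ {i j : Fin (N + 2 + 4)}, configPt N d i = configPt N d j → i.val < 3 →
      j.val < 3 := by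
    intro i j hij hi
    by_contra! hj
    obtain ⟨k, rfl⟩ := exists_addNat hj
    apply single_notMem_configLine (K := K) k
    rw [← configVec_addNat (d := d), ← configPt_le_iff, ← hij, configPt_le_iff]
    exact configVec_mem_configLine hi
  intro i j hij
  rcases lt_or_ge i.val 3 with hi | hi
  · rcases eq_zero_or_one_or_two hi with rfl | rfl | rfl <;>
      rcases eq_zero_or_one_or_two (hlt hij hi) with rfl | rfl | rfl <;>
      first
        | rfl
        | exact absurd hij ‹_›
        | exact absurd hij.symm ‹_›
  · have hj : 3 ≤ j.val := by
      by_contra! hj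
      exact absurd (hlt hij.symm hj) (by omega)
    obtain ⟨k, rfl⟩ := exists_addNat hi
    obtain ⟨k', rfl⟩ := exists_addNat hj
    rw [configPt, configPt, Projectivization.mk_eq_mk_iff'] at hij
    obtain ⟨a, ha⟩ := hij
    rw [configVec_addNat, configVec_addNat] at ha
    have := congrFun ha k
    by_contra hne
    have hkk : k ≠ k' := fun e => hne (by rw [e])
    simp [hkk] at this

theorem isConfig_configPt (hd : d ≠ 0) :
    IsConfig (configPt N d) (coordPlane K N) (configLine K N) where
  injective := configPt_injective hd
  finrank_plane := finrank_coordPlane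
  finrank_line := finrank_configLine
  line_le := configLine_le
  le_line i hi := configPt_le_iff.2 (configVec_mem_configLine hi)
  not_le_line k h := by
    rw [configPt_le_iff, configVec_addNat] at h
    exact single_notMem_configLine k h
  le_plane k hk := by
    rw [configPt_le_iff, configVec_addNat]
    exact single_mem_coordPlane hk
  span_eq := by
    rw [eq_top_iff, ← (Pi.basisFun K (Fin (N + 2 + 1))).span_eq, Submodule.span_le]
    rintro _ ⟨k, rfl⟩
    rw [Pi.basisFun_apply, ← configVec_addNat (d := d)]
    exact le_iSup (fun k : Fin (N + 2 + 1) => (configPt N d (k.addNat 3)).submodule) k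
      (configPt_le_iff.1 le_rfl)

theorem isPlanarSix_configPt (hd : d ≠ 0) (hd' : 1 + d ≠ 0) (h : 6 ≤ N + 2 + 4) :
    IsPlanarSix (fun i : Fin 6 => configPt N d (Fin.castLE h i)) := by
  have hc := isConfig_configPt (N := N) hd
  refine ⟨hc.injective.comp (Fin.castLE_injective h), coordPlane K N, configLine K N,
    coordLine K N, finrank_coordPlane, finrank_configLine, finrank_coordLine, configLine_le,
    coordLine_le, ?_, ?_, ?_, ?_, ?_, ?_⟩
  · intro e
    apply single_notMem_configLine (K := K) (0 : Fin (N + 2 + 1))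
    rw [e]
    exact Submodule.subset_span ⟨0, rfl⟩
  · exact fun i hi => ⟨hc.le_line _ hi,
      fun hl => configVec_notMem_coordLine hd' (i := Fin.castLE h i) hi (configPt_le_iff.1 hl)⟩
  · intro i hi hi'
    have : i = 3 ∨ i = 4 := by omega
    rcases this with rfl | rfl
    · refine ⟨?_, hc.not_le_line 0⟩
      change (configPt N d ((0 : Fin (N + 2 + 1)).addNat 3)).submodule ≤ _
      rw [configPt_le_iff, configVec_addNat]
      exact Submodule.subset_span ⟨0, rfl⟩
    · refine ⟨?_, hc.not_le_line 1⟩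
      change (configPt N d ((1 : Fin (N + 2 + 1)).addNat 3)).submodule ≤ _
      rw [configPt_le_iff, configVec_addNat]
      exact Submodule.subset_span ⟨1, rfl⟩
  · exact hc.le_plane 2 (by simp)
  · exact hc.not_le_line 2
  · intro hl
    change (configPt N d ((2 : Fin (N + 2 + 1)).addNat 3)).submodule ≤ _ at hl
    rw [configPt_le_iff, configVec_addNat] at hl
    have := apply_two_eq_zero_of_mem_coordLine hl
    simp at this

end FatPoints

end

theorem corollary4p5 {K : Type*} [Field K] [IsAlgClosed K] :
    -- six points in the plane, for every choice of the configuration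
    (∀ m : ℕ, 1 ≤ m → ∀ Q : Fin 6 → FatPoints.PSpace K 2, FatPoints.IsPlanarSix Q →
      FatPoints.Nondegenerate Q ∧
      FatPoints.segreT Q (fun _ => m) 1 = 3 * m - 1 ∧
      FatPoints.segreT Q (fun _ => m) 2 = 3 * m ∧
      FatPoints.segreBound Q (fun _ => m) = 3 * m ∧
      FatPoints.regIndex Q (fun _ => m) = 3 * m - 1 ∧
      FatPoints.regIndex Q (fun _ => m) < FatPoints.segreBound Q (fun _ => m)) ∧
    -- `n + 4` points in projective `n`-space, the first six as above in some plane
    (∀ m n : ℕ, 1 ≤ m → ∀ hn : 2 ≤ n, ∃ P : Fin (n + 4) → FatPoints.PSpace K n,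
      Function.Injective P ∧
      FatPoints.IsPlanarSix (fun i : Fin 6 => P (Fin.castLE (by omega) i)) ∧
      FatPoints.Nondegenerate (fun i : {i : Fin (n + 4) // 3 ≤ i.val} => P i) ∧
      FatPoints.Nondegenerate P ∧
      FatPoints.regIndex P (fun _ => m) = 3 * m - 1 ∧
      FatPoints.segreBound P (fun _ => m) = 3 * m ∧
      FatPoints.regIndex P (fun _ => m) < FatPoints.segreBound P (fun _ => m)) := by
  have : Infinite K := IsAlgClosed.instInfinite
  constructor
  · intro m hm Q hQ
    obtain ⟨α, l, h⟩ := hQ.exists_isConfig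
    refine ⟨h.nondegenerate, h.segreT_one m, h.segreT_two m, h.segreBound_eq m,
      h.regIndex_eq hm, ?_⟩
    have h1 := h.regIndex_eq hm
    have h2 := h.segreBound_eq m
    exact h1.trans_lt ((by omega : 3 * m - 1 < 3 * m).trans_eq h2.symm)
  · intro m n hm hn
    obtain ⟨N, rfl⟩ := Nat.exists_eq_add_of_le' hn
    classical
    obtain ⟨d, hd⟩ := Infinite.exists_notMem_finset ({0, -1} : Finset K)
    simp only [Finset.mem_insert, Finset.mem_singleton, not_or] at hd
    have h := FatPoints.isConfig_configPt (N := N) hd.1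
    refine ⟨FatPoints.configPt N d, h.injective, FatPoints.isPlanarSix_configPt hd.1
      (fun h => hd.2 (eq_neg_of_add_eq_zero_right h)) _, h.nondegenerate_subtype, h.nondegenerate,
      h.regIndex_eq hm, h.segreBound_eq m, ?_⟩
    rw [h.regIndex_eq hm, h.segreBound_eq m]
    omega
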